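/- Let $N\ge 1$, $T>0$, $r_0>0$, and for complex $\epsilon$ with $|\epsilon|<r_0$ and $t\in\mathbb R$ let $$A_\epsilon(t)=\sum_{n\ge 0}\epsilon^n A_n(t)\in\mathbb C^{N\times N},$$ where the series converges for all $|\epsilon|<r_0$ and all $t\in\mathbb R$, $(\epsilon,t)\mapsto A_\epsilon(t)$ is continuous, and each $A_\epsilon$ is $T$-periodic in $t$. Suppose that $A_0(t)\equiv A_0$ is constant and diagonal and that for every $n\ge 1$ the function $A_n$ has a finite Fourier series $A_n(t)=\sum_{m}e^{2\pi i m t/T}A_n^{(m)}$. Let $F_0$ be the diagonal matrix with $(A_0)_{kk}-(F_0)_{kk}\in\frac{2\pi i}{T}\mathbb Z$ and $\operatorname{Im}(F_0)_{kk}\in(-\pi/T,\pi/T]$ for all $k$. A Floquet–Lyapunov decomposition of $dx/dt=A_\epsilon(t)x$ is a pair $(P_\epsilon,F_\epsilon)$ of a $T$-periodic matrix function $P_\epsilon$ and a matrix $F_\epsilon\in\mathbb C^{N\times N}$ such that the fundamental solution $X_\epsilon$ (with $X_\epsilon(0)=\mathrm{Id}$) is $X_\epsilon(t)=P_\epsilon(t)\exp(F_\epsilon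 t)$. The Floquet exponents of the system are the eigenvalues of such matrices $F_\epsilon$. Suppose that $(F_0)_{ii}$ is a simple constant-order Floquet exponent, i.e. $(F_0)_{jj}\ne(F_0)_{ii}$ for all $j\neq i$, and that $A_1$ has no constant Fourier component, $A_1^{(0)}=\frac1T\int_0^T A_1(t)\,dt=0$. Then there is a function $f_i$, the Floquet exponent corresponding to $(F_0)_{ii}$, with the following properties: $f_i(0)=(F_0)_{ii}$; there is $\delta>0$ such that for all sufficiently small $\epsilon$ the number $f_i(\epsilon)$ is the one and only Floquet exponent of $dx/dt=A_\epsilon(t)x$ within distance less than $\delta$ of $(F_0)_{ii}$; for every family of Floquet–Lyapunov decompositions $(P_\epsilon,F_\epsilon)$ in which $F_\epsilon$ takes the value $F_0$ at $\epsilon=0$ and is continuous there (in particular, when it is analytic in $\epsilon$), $f_i(\epsilon)$ is an eigenvalue of $F_\epsilon$ for all sufficiently small $\epsilon$; and $$f_i(\epsilon)=(F_0)_{ii}+O(\epsilon^2)\qquad(\epsilon\to 0),$$ so that there is no linear perturbation. -/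

import Mathlib

open Filter Topology Asymptotics

noncomputable section

/-- `X` is the fundamental solution of `dx/dt = A(t) x`, normalised by `X(0) = Id`. -/
def IsFundamentalSolution {N : ℕ} (A X : ℝ → Matrix (Fin N) (Fin N) ℂ) : Prop :=
  X 0 = 1 ∧ ∀ (t : ℝ) (k l : Fin N), HasDerivAt (fun s : ℝ => X s k l) ((A t * X t) k l) t

/-- `(P, F)` is a Floquet-Lyapunov decomposition of the `T`-periodic system `dx/dt = A(t) x`: `P` is
`T`-periodic and `P(t) exp(F t)` is the fundamental solution. -/
def IsFloquetDecomposition {N : ℕ} (T : ℝ) (A P : ℝ → Matrix (Fin N) (Fin N) ℂ)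
    (F : Matrix (Fin N) (Fin N) ℂ) : Prop :=
  Function.Periodic P T ∧
    IsFundamentalSolution A (fun t : ℝ => P t * NormedSpace.exp ((t : ℂ) • F))

/-- `μ` is a Floquet exponent of the `T`-periodic system `dx/dt = A(t) x`: an eigenvalue of some
Floquet exponent matrix. -/
def IsFloquetExponent {N : ℕ} (T : ℝ) (A : ℝ → Matrix (Fin N) (Fin N) ℂ) (μ : ℂ) : Prop :=
  ∃ (P : ℝ → Matrix (Fin N) (Fin N) ℂ) (F : Matrix (Fin N) (Fin N) ℂ),
    IsFloquetDecomposition T A P F ∧ Module.End.HasEigenvalue (Matrix.toLin' F) μ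

/-- `B(t) = ∑ exp(2πi m t / T) c_m`, a finite sum over integers `m`. -/
def HasFiniteFourierSeries {N : ℕ} (T : ℝ) (B : ℝ → Matrix (Fin N) (Fin N) ℂ) : Prop :=
  ∃ (s : Finset ℤ) (c : ℤ → Matrix (Fin N) (Fin N) ℂ), ∀ t : ℝ,
    B t = ∑ m ∈ s, Complex.exp (2 * Real.pi * Complex.I / T * m * t) • c m

/-- The assumptions on the family of coefficient matrices `A ε t = ∑ ε ^ n • a n t`, for complex `ε`
with `‖ε‖ < r₀`. -/
structure IsModulatedSystem {N : ℕ} (T r₀ : ℝ) (A : ℂ → ℝ → Matrix (Fin N) (Fin N) ℂ)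
    (a : ℕ → ℝ → Matrix (Fin N) (Fin N) ℂ) (A₀ : Matrix (Fin N) (Fin N) ℂ) : Prop where
  periodic : ∀ ε : ℂ, ‖ε‖ < r₀ → Function.Periodic (A ε) T
  continuous : ContinuousOn (fun p : ℂ × ℝ => A p.1 p.2) {p : ℂ × ℝ | ‖p.1‖ < r₀}
  hasSum : ∀ ε : ℂ, ‖ε‖ < r₀ → ∀ t : ℝ, HasSum (fun n : ℕ => ε ^ n • a n t) (A ε t)
  leading_const : ∀ t : ℝ, a 0 t = A₀
  leading_diag : A₀.IsDiag
  finite_fourier : ∀ n : ℕ, 1 ≤ n → HasFiniteFourierSeries T (a n)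

/-- `F₀` is the diagonal matrix congruent to the diagonal matrix `A₀` modulo `(2πi/T) ℤ` in every
diagonal entry, with the imaginary parts of its diagonal entries in `(-π/T, π/T]`. -/
structure IsConstantOrderFloquetMatrix {N : ℕ} (T : ℝ) (A₀ F₀ : Matrix (Fin N) (Fin N) ℂ) :
    Prop where
  diag : F₀.IsDiag
  congr : ∀ k : Fin N, ∃ n : ℤ, A₀ k k - F₀ k k = 2 * Real.pi * Complex.I / T * n
  im_mem : ∀ k : Fin N, (F₀ k k).im ∈ Set.Ioc (-(Real.pi / T)) (Real.pi / T)

end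

/-! All exponents are read off the monodromy matrix `X ε T`, which equals `exp (T F)` for every
Floquet–Lyapunov decomposition. Factoring out `exp (t A₀)` leaves a system whose coefficient is `exp
(-t A₀) (A ε t - A₀) exp (t A₀)`, of size O(ε). Its Volterra series gives, at time `T`, the identity
plus ε times the integral of the conjugated `a 1`, plus O(ε²). Conjugation by a diagonal exponential
fixes diagonal entries, so a vanishing mean of `a 1` removes the linear term from the diagonal
(`IsModulatedSystem.exists_monodromy`).

Thus `X ε T` is within O(ε) of the diagonal matrix `D = exp (T F₀)`, and within O(ε²) on the
diagonal. The choice of imaginary parts makes `exp (T ·)` injective on the diagonal entries of `F₀`,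
so the eigenvalue `exp (T (F₀)ᵢᵢ)` of `D` is simple. Off-diagonal entries enter the characteristic
determinant at least in pairs, so the perturbed eigenvalue agrees with the diagonal entry up to
O(ε²) (`Matrix.IsDiag.exists_simple_eigenvalue`). The exponential has nonzero derivative, which
carries the estimate to the exponent.

The same injectivity makes the matrix exponential locally invertible at `T F₀` (`exists_local_log`).
The local logarithm supplies a continuous exponent matrix, whose eigenvalue near `(F₀)ᵢᵢ` is `f`,
and any other continuous family through `F₀` must coincide with it. -/

/-! ### Volterra series of a linear equation -/

section Volterra

variable {𝔸 : Type*} [NormedRing 𝔸] [NormedAlgebra ℝ 𝔸]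

/-- The terms of the Volterra (Dyson) series of the linear equation `dX/dt = B(t) X`. -/
noncomputable def volterraTerm (B : ℝ → 𝔸) : ℕ → ℝ → 𝔸
  | 0 => fun _ => 1
  | n + 1 => fun t => ∫ s in (0 : ℝ)..t, B s * volterraTerm B n s

/-- The sum of the Volterra series of `dX/dt = B(t) X`. -/
noncomputable def volterraSum (B : ℝ → 𝔸) (t : ℝ) : 𝔸 := ∑' n, volterraTerm B n t

variable {B : ℝ → 𝔸}

theorem continuous_volterraTerm (hB : Continuous B) (n : ℕ) : Continuous (volterraTerm B n) := by
  induction n with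
  | zero => exact continuous_const
  | succ n ih =>
    exact intervalIntegral.continuous_primitive
      (fun a b => (hB.mul ih).intervalIntegrable a b) 0

theorem hasDerivAt_volterraTerm_succ [CompleteSpace 𝔸] (hB : Continuous B) (n : ℕ) (t : ℝ) :
    HasDerivAt (volterraTerm B (n + 1)) (B t * volterraTerm B n t) t :=
  have hc := hB.mul (continuous_volterraTerm hB n)
  intervalIntegral.integral_hasDerivAt_right (hc.intervalIntegrable _ _)
    hc.stronglyMeasurable.stronglyMeasurableAtFilter hc.continuousAt

theorem norm_volterraTerm_le (hB : Continuous B) {K R : ℝ}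
    (hK : ∀ s, |s| ≤ R → ‖B s‖ ≤ K) (n : ℕ) :
    ∀ t, |t| ≤ R → ‖volterraTerm B n t‖ ≤ ‖(1 : 𝔸)‖ * ((K * |t|) ^ n / n.factorial) := by
  induction n with
  | zero => intro t _; simp [volterraTerm]
  | succ n ih =>
    intro t ht
    have hK0 : 0 ≤ K := (norm_nonneg _).trans (hK 0 (by simpa using (abs_nonneg t).trans ht))
    -- The form `|s - 0| ^ n` is the one in `integral_pow_abs_sub_uIoc`, valid for either sign of
    -- `t`.
    have hle : ∀ s ∈ Set.uIoc 0 t, ‖B s * volterraTerm B n s‖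
        ≤ ‖(1 : 𝔸)‖ * K ^ (n + 1) / n.factorial * |s - 0| ^ n := by
      intro s hs
      have hs' : |s| ≤ R := by
        refine le_trans ?_ ht
        have := Set.abs_sub_left_of_mem_uIcc (Set.uIoc_subset_uIcc hs)
        simpa using this
      calc ‖B s * volterraTerm B n s‖ ≤ ‖B s‖ * ‖volterraTerm B n s‖ := norm_mul_le _ _
        _ ≤ K * (‖(1 : 𝔸)‖ * ((K * |s|) ^ n / n.factorial)) :=
          mul_le_mul (hK s hs') (ih s hs') (norm_nonneg _) hK0
        _ = _ := by rw [sub_zero]; ring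
    have hc := hB.mul (continuous_volterraTerm hB n)
    calc ‖volterraTerm B (n + 1) t‖
        ≤ ∫ s in Set.uIoc 0 t, ‖B s * volterraTerm B n s‖ :=
          intervalIntegral.norm_integral_le_integral_norm_uIoc
      _ ≤ ∫ s in Set.uIoc 0 t, ‖(1 : 𝔸)‖ * K ^ (n + 1) / n.factorial * |s - 0| ^ n := by
          refine MeasureTheory.setIntegral_mono_on ?_ ?_ measurableSet_uIoc hle
          · exact (hc.norm.intervalIntegrable 0 t).def'
          · exact ((by fun_prop : Continuous fun s : ℝ =>
              ‖(1 : 𝔸)‖ * K ^ (n + 1) / n.factorial * |s - 0| ^ n).intervalIntegrable 0 t).def'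
      _ = _ := by
          rw [MeasureTheory.integral_const_mul, integral_pow_abs_sub_uIoc, Nat.factorial_succ]
          push_cast
          rw [sub_zero]
          field_simp
          ring

theorem summable_volterra_bound (c x : ℝ) :
    Summable fun n : ℕ => c * (x ^ n / n.factorial) :=
  (Real.summable_pow_div_factorial x).mul_left c

omit [NormedAlgebra ℝ 𝔸] in
theorem exists_norm_le_of_abs_le (hB : Continuous B) (R : ℝ) :
    ∃ K, ∀ s, |s| ≤ R → ‖B s‖ ≤ K := by
  obtain ⟨K, hK⟩ := (isCompact_Icc (a := -R) (b := R)).exists_bound_of_continuousOn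
    hB.continuousOn
  exact ⟨K, fun s hs => hK s (abs_le.mp hs)⟩

variable [CompleteSpace 𝔸]

theorem summable_volterraTerm (hB : Continuous B) (t : ℝ) :
    Summable fun n => volterraTerm B n t := by
  obtain ⟨K, hK⟩ := exists_norm_le_of_abs_le hB |t|
  exact .of_norm_bounded (summable_volterra_bound _ _)
    fun n => norm_volterraTerm_le hB hK n t le_rfl

omit [CompleteSpace 𝔸] in
theorem volterraSum_zero : volterraSum B 0 = 1 := by
  rw [volterraSum, tsum_eq_single 0]
  · rfl
  · rintro (_ | n) hn
    · exact absurd rfl hn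
    · simp [volterraTerm]

theorem hasDerivAt_volterraSum (hB : Continuous B) (t : ℝ) :
    HasDerivAt (volterraSum B) (B t * volterraSum B t) t := by
  -- Termwise differentiation needs a summable bound on an open interval around `t`.
  set R := |t| + 1
  obtain ⟨K, hK⟩ := exists_norm_le_of_abs_le hB R
  have hK0 : 0 ≤ K := (norm_nonneg _).trans (hK 0 (by simp [R]; positivity))
  let g' : ℕ → ℝ → 𝔸 := fun n s => match n with
    | 0 => 0
    | n + 1 => B s * volterraTerm B n s
  let u : ℕ → ℝ := fun n => match n with
    | 0 => 0
    | n + 1 => K * (‖(1 : 𝔸)‖ * ((K * R) ^ n / n.factorial))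
  have hu : Summable u :=
    (summable_nat_add_iff 1).mp ((summable_volterra_bound _ _).mul_left K)
  have hg : ∀ n y, y ∈ Set.Ioo (-R) R → HasDerivAt (volterraTerm B n) (g' n y) y := by
    rintro (_ | n) y _
    · exact hasDerivAt_const _ _
    · exact hasDerivAt_volterraTerm_succ hB n y
  have hg' : ∀ n y, y ∈ Set.Ioo (-R) R → ‖g' n y‖ ≤ u n := by
    rintro (_ | n) y hy
    · simp [g', u]
    · have hy' : |y| ≤ R := (abs_lt.mpr hy).le
      refine (norm_mul_le _ _).trans (mul_le_mul (hK y hy') ?_ (norm_nonneg _) hK0)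
      refine (norm_volterraTerm_le hB hK n y hy').trans ?_
      gcongr
  have ht : t ∈ Set.Ioo (-R) R := abs_lt.mp (lt_add_one _)
  have h := hasDerivAt_tsum_of_isPreconnected hu isOpen_Ioo isPreconnected_Ioo hg hg' ht
    (summable_volterraTerm hB t) ht
  convert! h using 1
  rw [Summable.tsum_eq_zero_add (.of_norm_bounded hu fun n => hg' n t ht)]
  simp only [g', zero_add]
  exact ((summable_volterraTerm hB t).tsum_mul_left _).symm

/-- The terms from index 2 on are dominated by the tail `exp x - 1 - x` at `x = K * T`, which is at
most `x ^ 2` for `x ≤ 1`. -/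
theorem norm_volterraSum_sub_le (hB : Continuous B) {K T : ℝ} (hT : 0 ≤ T)
    (hK : ∀ s, |s| ≤ T → ‖B s‖ ≤ K) (hKT : K * T ≤ 1) :
    ‖volterraSum B T - 1 - ∫ s in (0 : ℝ)..T, B s‖ ≤ ‖(1 : 𝔸)‖ * (K * T) ^ 2 := by
  have hK0 : 0 ≤ K := (norm_nonneg _).trans (hK 0 (by simpa using hT))
  have hs := summable_volterraTerm hB T
  have h2 : volterraSum B T - 1 - ∫ s in (0 : ℝ)..T, B s
      = ∑' n, volterraTerm B (n + 2) T := by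
    rw [volterraSum, ← hs.sum_add_tsum_nat_add 2]
    simp only [Finset.sum_range_succ, Finset.sum_range_zero, zero_add, volterraTerm, mul_one]
    abel
  have hexp := NormedSpace.expSeries_div_hasSum_exp (K * T)
  rw [← Real.exp_eq_exp_ℝ] at hexp
  have h3 : HasSum (fun n : ℕ => ‖(1 : 𝔸)‖ * ((K * T) ^ (n + 2) / (n + 2).factorial))
      (‖(1 : 𝔸)‖ * (Real.exp (K * T) - 1 - K * T)) := by
    refine HasSum.mul_left _ ?_
    rw [hasSum_nat_add_iff (f := fun n : ℕ => (K * T) ^ n / n.factorial) 2]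
    convert! hexp using 1
    simp [Finset.sum_range_succ]
  rw [h2]
  refine (tsum_of_norm_bounded h3 fun n => ?_).trans ?_
  · simpa [abs_of_nonneg hT] using norm_volterraTerm_le hB hK (n + 2) T (abs_of_nonneg hT).le
  · refine mul_le_mul_of_nonneg_left ?_ (norm_nonneg _)
    exact (le_abs_self _).trans
      (Real.abs_exp_sub_one_sub_id_le (by rwa [abs_of_nonneg (by positivity)]))

end Volterra

/-! ### Taylor remainders of vector-valued power series -/

section PowerSeries

variable {E : Type*} [NormedAddCommGroup E] [NormedSpace ℂ E]

theorem differentiableOn_of_hasSum_pow_smul [CompleteSpace E] {c : ℕ → E} {q : ℂ → E} {r₀ r : ℝ}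
    (hq : ∀ z : ℂ, ‖z‖ < r₀ → HasSum (fun n : ℕ => z ^ n • c n) (q z)) (hr : 0 < r) (hr' : r < r₀) :
    DifferentiableOn ℂ q (Metric.ball 0 r) := by
  -- Convergence at the larger radius `ρ` bounds the coefficients, giving a geometric majorant of
  -- ratio `r / ρ`.
  obtain ⟨ρ, hρ, hρ'⟩ := exists_between hr'
  have hρ0 : 0 < ρ := hr.trans hρ
  have hρn : ‖(ρ : ℂ)‖ = ρ := by simp [abs_of_pos hρ0]
  obtain ⟨C, hC⟩ := ((hq ρ (by rwa [hρn])).summable.tendsto_atTop_zero.norm).bddAbove_range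
  have hle : ∀ (n : ℕ) (w : ℂ), w ∈ Metric.ball (0 : ℂ) r → ‖w ^ n • c n‖ ≤ C * (r / ρ) ^ n := by
    intro n w hw
    have hw' : ‖w‖ ≤ r := (mem_ball_zero_iff.mp hw).le
    have h1 : ρ ^ n * ‖c n‖ ≤ C := by
      have := hC ⟨n, rfl⟩
      simpa [norm_smul, abs_of_pos hρ0] using this
    calc ‖w ^ n • c n‖ = ‖w‖ ^ n * ‖c n‖ := by rw [norm_smul, norm_pow]
      _ ≤ r ^ n * ‖c n‖ := by gcongr
      _ = (ρ ^ n * ‖c n‖) * (r / ρ) ^ n := by rw [div_pow]; field_simp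
      _ ≤ C * (r / ρ) ^ n := by gcongr
  have hu : Summable fun n : ℕ => C * (r / ρ) ^ n :=
    (summable_geometric_of_lt_one (by positivity) ((div_lt_one hρ0).mpr hρ)).mul_left C
  refine (Complex.differentiableOn_tsum_of_summable_norm hu (fun n => ?_) Metric.isOpen_ball hle).congr ?_
  · fun_prop
  · intro w hw
    exact (hq w ((mem_ball_zero_iff.mp hw).trans hr')).tsum_eq.symm

/-- Division of a bounded power series by its variable. -/
theorem exists_shift_of_hasSum_pow_smul [CompleteSpace E] {c : ℕ → E} {q : ℂ → E} {r₀ r K : ℝ}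
    (hq : ∀ z : ℂ, ‖z‖ < r₀ → HasSum (fun n : ℕ => z ^ n • c n) (q z)) (hr : 0 < r) (hr' : r < r₀)
    (hK : ∀ z : ℂ, ‖z‖ ≤ r → ‖q z‖ ≤ K) :
    ∃ p : ℂ → E, (∀ z : ℂ, ‖z‖ < r₀ → HasSum (fun n : ℕ => z ^ n • c (n + 1)) (p z)) ∧
      (∀ z : ℂ, ‖z‖ < r₀ → q z = c 0 + z • p z) ∧ ∀ z : ℂ, ‖z‖ ≤ r → ‖p z‖ ≤ 2 * K / r := by
  have hsum : ∀ z : ℂ, ‖z‖ < r₀ → Summable fun n : ℕ => z ^ n • c (n + 1) := by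
    intro z hz
    rcases eq_or_ne z 0 with rfl | hz0
    · refine summable_of_ne_finset_zero (s := {0}) fun n hn => ?_
      simp_all
    · have := ((summable_nat_add_iff 1).mpr (hq z hz).summable).const_smul z⁻¹
      refine this.congr fun n => ?_
      rw [smul_smul, pow_succ', inv_mul_cancel_left₀ hz0]
  have hp : ∀ z : ℂ, ‖z‖ < r₀ →
      HasSum (fun n : ℕ => z ^ n • c (n + 1)) (∑' n : ℕ, z ^ n • c (n + 1)) :=
    fun z hz => (hsum z hz).hasSum
  have hqp : ∀ z : ℂ, ‖z‖ < r₀ → q z = c 0 + z • ∑' n : ℕ, z ^ n • c (n + 1) := by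
    intro z hz
    rw [← (hq z hz).tsum_eq, (hq z hz).summable.tsum_eq_zero_add, ← (hsum z hz).tsum_const_smul]
    simp [smul_smul, pow_succ']
  refine ⟨fun z => ∑' n : ℕ, z ^ n • c (n + 1), hp, hqp, fun z hz => ?_⟩
  have hc0 : ‖c 0‖ ≤ K := by
    have := hqp 0 (by simpa using hr.trans hr')
    rw [zero_smul, add_zero] at this
    exact this ▸ hK 0 (by simpa using hr.le)
  obtain ⟨ρ, hρ, hρ'⟩ := exists_between hr'
  have hd : DifferentiableOn ℂ (fun z : ℂ => ∑' n : ℕ, z ^ n • c (n + 1)) (Metric.ball 0 ρ) :=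
    differentiableOn_of_hasSum_pow_smul hp (hr.trans hρ) hρ'
  have hcl : closure (Metric.ball (0 : ℂ) r) = Metric.closedBall 0 r := closure_ball _ hr.ne'
  -- Maximum principle: dividing by `z` costs exactly `1 / r` on the circle, and the bound there
  -- extends inside.
  refine Complex.norm_le_of_forall_mem_frontier_norm_le (U := Metric.ball (0 : ℂ) r)
    (f := fun z : ℂ => ∑' n : ℕ, z ^ n • c (n + 1))
    Metric.isBounded_ball ?_ ?_ (z := z) ?_
  · refine DifferentiableOn.diffContOnCl (hd.mono ?_)
    rw [hcl]
    exact Metric.closedBall_subset_ball hρ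
  · intro w hw
    rw [frontier_ball _ hr.ne', mem_sphere_zero_iff_norm] at hw
    have h1 := hqp w (hw ▸ hr')
    have h2 : r * ‖∑' n : ℕ, w ^ n • c (n + 1)‖ ≤ 2 * K := by
      rw [← hw, ← norm_smul, ← sub_eq_of_eq_add' h1]
      have := hK w hw.le
      linarith [norm_sub_le (q w) (c 0)]
    rw [le_div_iff₀ hr]
    linarith
  · rw [hcl]
    simpa using hz

/-- The first-order Taylor remainder of a power series bounded by `K` on `‖z‖ ≤ r`. -/
theorem norm_sub_sub_le_of_hasSum_pow_smul [CompleteSpace E] {c : ℕ → E} {q : ℂ → E} {r₀ r K : ℝ}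
    (hq : ∀ z : ℂ, ‖z‖ < r₀ → HasSum (fun n : ℕ => z ^ n • c n) (q z)) (hr : 0 < r) (hr' : r < r₀)
    (hK : ∀ z : ℂ, ‖z‖ ≤ r → ‖q z‖ ≤ K) {z : ℂ} (hz : ‖z‖ ≤ r) :
    ‖q z - c 0‖ ≤ 2 * K / r * ‖z‖ ∧
      ‖q z - c 0 - z • c 1‖ ≤ 2 * (2 * K / r) / r * ‖z‖ ^ 2 := by
  obtain ⟨p, hp, hqp, hpK⟩ := exists_shift_of_hasSum_pow_smul hq hr hr' hK
  obtain ⟨p', -, hpp', hpK'⟩ := exists_shift_of_hasSum_pow_smul hp hr hr' hpK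
  have hz' := hz.trans_lt hr'
  constructor
  · rw [hqp z hz', add_sub_cancel_left, norm_smul, mul_comm]
    exact mul_le_mul_of_nonneg_right (hpK z hz) (norm_nonneg z)
  · rw [hqp z hz', add_sub_cancel_left, ← smul_sub, hpp' z hz', zero_add, add_sub_cancel_left,
      smul_smul, norm_smul, norm_mul, ← sq, mul_comm]
    exact mul_le_mul_of_nonneg_right (hpK' z hz) (by positivity)

end PowerSeries

/-! ### Local inverse of the exponential -/

section LocalLog

variable {𝔸 : Type*} [NormedRing 𝔸] [NormedAlgebra ℂ 𝔸] [CompleteSpace 𝔸]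

/-- If commuting with `exp D` forces commuting with `D`, the derivative of the exponential at `D` is
injective. -/
theorem injective_of_hasFDerivAt_exp {D : 𝔸} {L : 𝔸 →L[ℂ] 𝔸}
    (hD : ∀ H, Commute (NormedSpace.exp D) H → Commute D H)
    (hL : HasFDerivAt (𝕜 := ℂ) NormedSpace.exp L D) : Function.Injective L := by
  rw [injective_iff_map_eq_zero]
  intro H hLH
  let _ : NormedAlgebra ℚ 𝔸 := NormedAlgebra.restrictScalars ℚ ℂ 𝔸
  have hcurve : HasDerivAt (fun s : ℂ => D + s • H) H 0 := by
    simpa only [one_smul, id] using ((hasDerivAt_id (0 : ℂ)).smul_const H).const_add D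
  have hexp : HasDerivAt (fun s : ℂ => NormedSpace.exp (D + s • H)) 0 0 := by
    have hL' : HasFDerivAt (𝕜 := ℂ) NormedSpace.exp L (D + (0 : ℂ) • H) := by simpa using hL
    have := HasFDerivAt.comp_hasDerivAt (0 : ℂ) hL' hcurve
    rw [hLH] at this
    exact this
  -- `exp (D + sH)` commutes with `D + sH` and has zero derivative at `s = 0`; differentiating the
  -- commutation there leaves `exp D * H = H * exp D`.
  have hcomm : Commute (NormedSpace.exp D) H := by
    have h1 := hexp.fun_mul hcurve
    have h2 := hcurve.fun_mul hexp
    have h3 : (fun s : ℂ => NormedSpace.exp (D + s • H) * (D + s • H))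
        = fun s : ℂ => (D + s • H) * NormedSpace.exp (D + s • H) := by
      funext s
      exact ((Commute.refl (D + s • H)).exp_left).eq
    rw [h3] at h1
    simpa [Commute, SemiconjBy] using h1.unique h2
  have hDH := hD H hcomm
  -- Now `D` and `H` commute, so the exponential splits and the same derivative is `exp D * H`.
  have hexp' : HasDerivAt (fun s : ℂ => NormedSpace.exp (D + s • H)) (NormedSpace.exp D * H) 0 := by
    have h1 : HasDerivAt (fun s : ℂ => NormedSpace.exp (s • H)) H 0 := by
      simpa using hasDerivAt_exp_smul_const (𝕂 := ℂ) H 0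
    have h2 : (fun s : ℂ => NormedSpace.exp (D + s • H))
        = fun s : ℂ => NormedSpace.exp D * NormedSpace.exp (s • H) :=
      funext fun s => NormedSpace.exp_add_of_commute (hDH.smul_right s)
    rw [h2]
    exact h1.const_mul (NormedSpace.exp D)
  exact (NormedSpace.isUnit_exp D).mul_right_eq_zero.mp (hexp'.unique hexp)

/-- A continuous logarithm near `exp D`, for `D` such that commuting with `exp D` forces commuting
with `D`. -/
theorem exists_local_log [FiniteDimensional ℂ 𝔸] {D : 𝔸}
    (hD : ∀ H, Commute (NormedSpace.exp D) H → Commute D H) :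
    ∃ ψ : 𝔸 → 𝔸, Tendsto ψ (𝓝 (NormedSpace.exp D)) (𝓝 D) ∧
      (∀ᶠ M in 𝓝 (NormedSpace.exp D), NormedSpace.exp (ψ M) = M) ∧
      ∀ᶠ H in 𝓝 D, ψ (NormedSpace.exp H) = H := by
  have hs := (NormedSpace.exp_analytic (𝕂 := ℂ) D).hasStrictFDerivAt
  let e : 𝔸 ≃L[ℂ] 𝔸 :=
    (LinearEquiv.ofInjectiveEndo (fderiv ℂ NormedSpace.exp D).toLinearMap
      (injective_of_hasFDerivAt_exp hD hs.hasFDerivAt)).toContinuousLinearEquiv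
  have he : HasStrictFDerivAt NormedSpace.exp (e : 𝔸 →L[ℂ] 𝔸) D := by
    have h : (e : 𝔸 →L[ℂ] 𝔸) = fderiv ℂ NormedSpace.exp D := by
      ext H
      rfl
    rw [h]
    exact hs
  exact ⟨he.localInverse, he.localInverse_tendsto, he.eventually_right_inverse,
    he.eventually_left_inverse⟩

end LocalLog

/-! ### Exponentials of complex matrices -/

section MatrixExp

variable {n : Type*} [Fintype n] [DecidableEq n]

theorem Matrix.exp_diagonal_complex (d : n → ℂ) :
    NormedSpace.exp (Matrix.diagonal d) = Matrix.diagonal fun j => Complex.exp (d j) := by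
  rw [Matrix.exp_diagonal, Complex.exp_eq_exp_ℂ]
  congr 1
  funext j
  exact Pi.coe_exp d j

/-- An eigenvalue `μ` of `A` gives the eigenvalue `exp μ` of `exp A`. -/
theorem Matrix.hasEigenvalue_exp {A : Matrix n n ℂ} {μ : ℂ}
    (h : Module.End.HasEigenvalue (Matrix.toLin' A) μ) :
    Module.End.HasEigenvalue (Matrix.toLin' (NormedSpace.exp A)) (Complex.exp μ) := by
  obtain ⟨v, hv⟩ := h.exists_hasEigenvector
  have hAv : A.mulVec v = μ • v := by simpa using hv.apply_eq_smul
  -- With every column equal to `v`, the eigenvector equation becomes an intertwining relation,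
  -- which passes to exponentials.
  let V : Matrix n n ℂ := Matrix.of fun i _ => v i
  have hV : SemiconjBy V (Matrix.diagonal fun _ => μ) A := by
    ext i j
    have := congrFun hAv i
    simp only [V, Matrix.mul_diagonal, Matrix.of_apply]
    rw [mul_comm]
    exact this.symm
  have hV' : V * Matrix.diagonal (fun _ => Complex.exp μ) = NormedSpace.exp A * V := by
    rw [← Matrix.exp_diagonal_complex]
    open scoped Matrix.Norms.Operator in exact hV.exp_right
  refine Module.End.hasEigenvalue_of_hasEigenvector (x := v)
    ⟨Module.End.mem_eigenspace_iff.mpr ?_, hv.2⟩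
  rw [Matrix.toLin'_apply]
  ext i
  have := congrFun (congrFun hV' i) i
  simp only [V, Matrix.mul_diagonal, Matrix.of_apply] at this
  rw [Pi.smul_apply, smul_eq_mul, mul_comm, this]
  rfl

/-- A nonzero entry `H j k` forces equality of the exponentials at `j` and `k`, hence of `d j` and
`d k`. -/
theorem Matrix.commute_diagonal_of_commute_exp {d : n → ℂ}
    (hd : ∀ j k, Complex.exp (d j) = Complex.exp (d k) → d j = d k) {H : Matrix n n ℂ}
    (h : Commute (NormedSpace.exp (Matrix.diagonal d)) H) : Commute (Matrix.diagonal d) H := by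
  ext j k
  have := congrFun (congrFun h.eq j) k
  rw [Matrix.exp_diagonal_complex, Matrix.diagonal_mul, Matrix.mul_diagonal] at this
  rw [Matrix.diagonal_mul, Matrix.mul_diagonal]
  rcases eq_or_ne (H j k) 0 with h0 | h0
  · simp [h0]
  · rw [mul_comm (H j k)] at this ⊢
    rw [hd j k (mul_right_cancel₀ h0 this)]

/-- A continuous logarithm near the exponential of a non-resonant diagonal matrix. -/
theorem Matrix.exists_local_log_diagonal {d : n → ℂ}
    (hd : ∀ j k, Complex.exp (d j) = Complex.exp (d k) → d j = d k) :
    ∃ ψ : Matrix n n ℂ → Matrix n n ℂ,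
      Tendsto ψ (𝓝 (NormedSpace.exp (Matrix.diagonal d))) (𝓝 (Matrix.diagonal d)) ∧
      (∀ᶠ M in 𝓝 (NormedSpace.exp (Matrix.diagonal d)), NormedSpace.exp (ψ M) = M) ∧
      ∀ᶠ H in 𝓝 (Matrix.diagonal d), ψ (NormedSpace.exp H) = H := by
  open scoped Matrix.Norms.Operator in
  exact exists_local_log fun H => Matrix.commute_diagonal_of_commute_exp hd

end MatrixExp

/-! ### Perturbation of a simple eigenvalue of a diagonal matrix -/

section SimpleEigenvalue

variable {n : Type*} [Fintype n] [DecidableEq n]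

theorem Matrix.hasEigenvalue_toLin'_iff_det {A : Matrix n n ℂ} {μ : ℂ} :
    Module.End.HasEigenvalue (Matrix.toLin' A) μ ↔ (Matrix.scalar n μ - A).det = 0 := by
  rw [Module.End.hasEigenvalue_iff_isRoot_charpoly, Matrix.charpoly_toLin', Polynomial.IsRoot.def,
    Matrix.eval_charpoly]

/-- The characteristic determinant as a function of the entries, on which the sup norm is used. -/
theorem contDiff_det_scalar_sub :
    ContDiff ℂ 1 fun p : (n → n → ℂ) × ℂ =>
      (Matrix.scalar n p.2 - Matrix.of p.1).det := by
  simp only [Matrix.det_apply']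
  refine ContDiff.sum fun σ _ => contDiff_const.mul (contDiff_prod fun j _ => ?_)
  simp only [Matrix.sub_apply, Matrix.scalar_apply, Matrix.diagonal_apply, Matrix.of_apply]
  split_ifs <;> fun_prop

theorem hasDerivAt_det_scalar_sub_diagonal (d : n → ℂ) (i : n) :
    HasDerivAt (fun z : ℂ => (Matrix.scalar n z - Matrix.diagonal d).det)
      (∏ j ∈ Finset.univ.erase i, (d i - d j)) (d i) := by
  have h : (fun z : ℂ => (Matrix.scalar n z - Matrix.diagonal d).det)
      = fun z => (z - d i) * ∏ j ∈ Finset.univ.erase i, (z - d j) := by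
    funext z
    rw [Matrix.scalar_apply, Matrix.diagonal_sub, Matrix.det_diagonal,
      Finset.mul_prod_erase _ (fun j => z - d j) (Finset.mem_univ i)]
  have h2 : DifferentiableAt ℂ (fun z => ∏ j ∈ Finset.univ.erase i, (z - d j)) (d i) := by
    fun_prop
  rw [h]
  simpa using ((hasDerivAt_id (d i)).sub_const (d i)).fun_mul h2.hasDerivAt

/-- At a diagonal entry, the characteristic determinant is of second order in the distance to a
diagonal matrix. -/
theorem isBigO_det_scalar_sub_apply {d : n → ℂ} {D : n → n → ℂ} (hD : D = Matrix.diagonal d)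
    (i : n) :
    (fun M : n → n → ℂ => (Matrix.scalar n (M i i) - Matrix.of M).det)
      =O[𝓝 D] fun M => ‖M - D‖ ^ 2 := by
  have hone : ∀ j k, (fun M : n → n → ℂ => (Matrix.scalar n (M i i) - Matrix.of M) j k)
      =O[𝓝 D] fun _ => (1 : ℝ) := by
    intro j k
    refine Tendsto.isBigO_one ℝ (ContinuousAt.tendsto (x := D) ?_)
    have hc : ∀ j k, ContinuousAt (fun M : n → n → ℂ => M j k) D := fun j k =>
      ((continuous_apply k).comp (continuous_apply j)).continuousAt
    simp only [Matrix.sub_apply, Matrix.scalar_apply, Matrix.diagonal_apply, Matrix.of_apply]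
    split_ifs
    · exact (hc i i).sub (hc j k)
    · exact continuousAt_const.sub (hc j k)
  have hoff : ∀ j k, j ≠ k → (fun M : n → n → ℂ => (Matrix.scalar n (M i i) - Matrix.of M) j k)
      =O[𝓝 D] fun M => ‖M - D‖ := by
    intro j k hjk
    refine IsBigO.of_bound 1 (Eventually.of_forall fun M => ?_)
    have h1 : ‖(M - D) j k‖ ≤ ‖M - D‖ := (norm_le_pi_norm _ k).trans (norm_le_pi_norm (M - D) j)
    have h2 : D j k = 0 := hD ▸ Matrix.diagonal_apply_ne d hjk
    simpa [Matrix.diagonal_apply_ne _ hjk, h2] using h1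
  simp only [Matrix.det_apply']
  suffices h : ∀ σ : Equiv.Perm n, (fun M : n → n → ℂ =>
      ∏ j, (Matrix.scalar n (M i i) - Matrix.of M) (σ j) j) =O[𝓝 D] fun M => ‖M - D‖ ^ 2 from
    IsBigO.fun_sum fun σ _ => (h σ).const_mul_left _
  intro σ
  by_cases hσ : σ = 1
  · subst hσ
    have : (fun M : n → n → ℂ =>
        ∏ j, (Matrix.scalar n (M i i) - Matrix.of M) ((1 : Equiv.Perm n) j) j) = fun _ => 0 := by
      funext M
      -- The identity permutation contributes the factor `M i i - M i i`.
      exact Finset.prod_eq_zero (Finset.mem_univ i) (by simp)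
    rw [this]
    exact isBigO_zero _ _
  · obtain ⟨j, hj⟩ : ∃ j, σ j ≠ j := by
      by_contra! h
      exact hσ (Equiv.ext h)
    -- A permutation that moves `j` also moves `σ j`, which gives two distinct off-diagonal factors.
    have hk : σ (σ j) ≠ σ j := fun h => hj (σ.injective h)
    have hprod : ∀ M : n → n → ℂ, ∏ l, (Matrix.scalar n (M i i) - Matrix.of M) (σ l) l
        = (Matrix.scalar n (M i i) - Matrix.of M) (σ j) j
          * ((Matrix.scalar n (M i i) - Matrix.of M) (σ (σ j)) (σ j)
          * ∏ l ∈ (Finset.univ.erase j).erase (σ j),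
            (Matrix.scalar n (M i i) - Matrix.of M) (σ l) l) := by
      intro M
      rw [Finset.mul_prod_erase _ (fun l => (Matrix.scalar n (M i i) - Matrix.of M) (σ l) l)
        (by simp [hj]), Finset.mul_prod_erase _
        (fun l => (Matrix.scalar n (M i i) - Matrix.of M) (σ l) l) (Finset.mem_univ j)]
    simp only [hprod]
    have hrest : (fun M : n → n → ℂ => ∏ l ∈ (Finset.univ.erase j).erase (σ j),
        (Matrix.scalar n (M i i) - Matrix.of M) (σ l) l) =O[𝓝 D] fun _ => (1 : ℝ) := by
      simpa using IsBigO.finsetProd (s := (Finset.univ.erase j).erase (σ j))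
        fun l _ => hone (σ l) l
    simpa [sq] using (hoff _ _ hj).mul ((hoff _ _ hk).mul hrest)

/-- Perturbation of a simple eigenvalue of a diagonal matrix: near `diagonal d` there is a unique
eigenvalue near `d i`, and it equals the `i`-th diagonal entry to second order. -/
theorem exists_simple_eigenvalue_of_eq_diagonal {d : n → ℂ} {D : n → n → ℂ}
    (hD : D = Matrix.diagonal d) {i : n} (hd : ∀ j, j ≠ i → d j ≠ d i) :
    ∃ φ : (n → n → ℂ) → ℂ, φ D = d i ∧
      Tendsto φ (𝓝 D) (𝓝 (d i)) ∧
      (∀ᶠ M in 𝓝 D,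
        (Matrix.scalar n (φ M) - Matrix.of M).det = 0) ∧
      (∀ᶠ p in 𝓝 (D, d i),
        (Matrix.scalar n p.2 - Matrix.of p.1).det = 0 → φ p.1 = p.2) ∧
      (fun M : n → n → ℂ => φ M - M i i)
        =O[𝓝 D] fun M => ‖M - D‖ ^ 2 := by
  let g : (n → n → ℂ) × ℂ → ℂ := fun p => (Matrix.scalar n p.2 - Matrix.of p.1).det
  set c : ℂ := ∏ j ∈ Finset.univ.erase i, (d i - d j)
  have hc : c ≠ 0 := Finset.prod_ne_zero_iff.mpr fun j hj =>
    sub_ne_zero.mpr (hd j (Finset.ne_of_mem_erase hj)).symm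
  have hg : HasStrictFDerivAt g (fderiv ℂ g (D, d i)) (D, d i) :=
    contDiff_det_scalar_sub.contDiffAt.hasStrictFDerivAt one_ne_zero
  have hg0 : g (D, d i) = 0 := by
    subst hD
    change (Matrix.scalar n (d i) - Matrix.diagonal d).det = 0
    rw [Matrix.scalar_apply, Matrix.diagonal_sub, Matrix.det_diagonal]
    exact Finset.prod_eq_zero (Finset.mem_univ i) (sub_self _)
  have hg2 : fderiv ℂ g (D, d i) ∘L .inr ℂ (n → n → ℂ) ℂ
      = ContinuousLinearMap.toSpanSingleton ℂ c := by
    have h1 : HasFDerivAt (fun z : ℂ => g (D, z))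
        (fderiv ℂ g (D, d i) ∘L .inr ℂ (n → n → ℂ) ℂ) (d i) :=
      hg.hasFDerivAt.comp (d i) (hasFDerivAt_prodMk_right D (d i))
    subst hD
    exact h1.unique (hasDerivAt_det_scalar_sub_diagonal d i).hasFDerivAt
  have hinv : (fderiv ℂ g (D, d i) ∘L .inr ℂ (n → n → ℂ) ℂ).IsInvertible := by
    rw [hg2]
    exact ⟨ContinuousLinearEquiv.unitsEquivAut ℂ (Units.mk0 c hc), by ext; simp⟩
  set φ := hg.implicitFunctionOfProdDomain hinv
  have hiff := hg.eventually_apply_eq_iff_implicitFunctionOfProdDomain hinv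
  have htend : Tendsto φ (𝓝 D) (𝓝 (d i)) := hg.tendsto_implicitFunctionOfProdDomain hinv
  have hroot : ∀ᶠ M in 𝓝 D, g (M, φ M) = 0 := by
    simpa only [hg0] using hg.eventually_apply_implicitFunctionOfProdDomain hinv
  refine ⟨φ, hiff.self_of_nhds.mp rfl, htend, hroot, ?_, ?_⟩
  · filter_upwards [hiff] with p hp h
    exact hp.mp (h.trans hg0.symm)
  · have hdiag : Tendsto (fun M : n → n → ℂ => M i i) (𝓝 D) (𝓝 (d i)) := by
      have : ContinuousAt (fun M : n → n → ℂ => M i i) D :=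
        ((continuous_apply i).comp (continuous_apply i)).continuousAt
      simpa [ContinuousAt, hD] using this
    have hpair : Tendsto (fun M : n → n → ℂ => ((M, φ M), (M, M i i))) (𝓝 D)
        (𝓝 ((D, d i), (D, d i))) :=
      (tendsto_id.prodMk_nhds htend).prodMk_nhds (tendsto_id.prodMk_nhds hdiag)
    -- Strict differentiability compares `(M, φ M)` with `(M, M i i)`. They differ only in the
    -- second variable, where the derivative is `c ≠ 0`, so `φ M - M i i` is controlled by the
    -- determinant at `M i i`.
    have hlit := hg.isLittleO.comp_tendsto hpair
    have hlit' : (fun M : n → n → ℂ => c * (φ M - M i i) - (g (M, φ M) - g (M, M i i)))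
        =o[𝓝 D] fun M => φ M - M i i := by
      refine (hlit.neg_left.congr_left fun M => ?_).trans_isBigO ?_
      · have h := DFunLike.congr_fun hg2 (φ M - M i i)
        simp only [ContinuousLinearMap.comp_apply, ContinuousLinearMap.inr_apply,
          ContinuousLinearMap.toSpanSingleton_apply, smul_eq_mul] at h
        have h' : ((M, φ M) : (n → n → ℂ) × ℂ) - (M, M i i) = (0, φ M - M i i) := by simp
        simp only [Function.comp_apply, h', h]
        ring
      · exact IsBigO.of_bound 1 (Eventually.of_forall fun M => by simp)
    have hO : (fun M : n → n → ℂ => φ M - M i i)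
        =O[𝓝 D] fun M => g (M, φ M) - g (M, M i i) := by
      have h1 : (fun M : n → n → ℂ => φ M - M i i) =O[𝓝 D] fun M => c * (φ M - M i i) :=
        isBigO_self_const_mul hc _ _
      have h2 := hlit'.trans_isBigO h1
      exact h1.trans (h2.right_isBigO_sub.congr_right fun M => by ring)
    refine hO.trans (IsBigO.congr' (isBigO_det_scalar_sub_apply hD i).neg_left ?_ EventuallyEq.rfl)
    filter_upwards [hroot] with M hM
    rw [hM, zero_sub]

/-- Perturbation of a simple eigenvalue of a diagonal matrix `D`: near `D` there is a unique
eigenvalue near `D i i`, and it equals the `i`-th diagonal entry to second order. -/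
theorem Matrix.IsDiag.exists_simple_eigenvalue {D : Matrix n n ℂ} (hD : D.IsDiag) {i : n}
    (hd : ∀ j, j ≠ i → D j j ≠ D i i) :
    ∃ φ : Matrix n n ℂ → ℂ, φ D = D i i ∧ Tendsto φ (𝓝 D) (𝓝 (D i i)) ∧
      (∀ᶠ M in 𝓝 D, Module.End.HasEigenvalue (Matrix.toLin' M) (φ M)) ∧
      (∀ᶠ p in 𝓝 (D, D i i), Module.End.HasEigenvalue (Matrix.toLin' p.1) p.2 → φ p.1 = p.2) ∧
      ∀ M : ℂ → Matrix n n ℂ, (∀ j k, (fun ε => M ε j k - D j k) =O[𝓝 0] fun ε => ε) →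
        (fun ε => φ (M ε) - M ε i i) =O[𝓝 0] fun ε => ε ^ 2 := by
  obtain ⟨φ, h1, h2, h3, h4, h5⟩ :=
    exists_simple_eigenvalue_of_eq_diagonal (d := D.diag) hD.diagonal_diag.symm hd
  refine ⟨φ, h1, h2, ?_, ?_, fun M hM => ?_⟩
  · simp only [Matrix.hasEigenvalue_toLin'_iff_det]
    exact h3
  · simp only [Matrix.hasEigenvalue_toLin'_iff_det]
    exact h4
  -- Viewed as functions, the matrices carry the sup norm used above.
  · let M' : ℂ → n → n → ℂ := M
    let D' : n → n → ℂ := D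
    have hO : (fun ε => M' ε - D') =O[𝓝 0] fun ε : ℂ => ε :=
      isBigO_pi.mpr fun j => isBigO_pi.mpr fun k => hM j k
    have ht : Tendsto M' (𝓝 0) (𝓝 D') :=
      tendsto_sub_nhds_zero_iff.mp (hO.trans_tendsto tendsto_id)
    exact (h5.comp_tendsto ht).trans (hO.norm_left.pow 2)

end SimpleEigenvalue

/-! ### Linear equations in the interaction picture -/

section LinearODE

variable {𝔸 : Type*} [NormedRing 𝔸] [NormedAlgebra ℝ 𝔸]

theorem eq_of_hasDerivAt_mul {A X Y : ℝ → 𝔸} (hA : Continuous A)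
    (hX : ∀ t, HasDerivAt X (A t * X t) t) (hY : ∀ t, HasDerivAt Y (A t * Y t) t)
    (h0 : X 0 = Y 0) : X = Y := by
  funext t
  set R := |t| + 1
  obtain ⟨K, hK⟩ := exists_norm_le_of_abs_le hA R
  have hlip : ∀ s ∈ Set.Ioo (-R) R,
      LipschitzOnWith K.toNNReal (fun x : 𝔸 => A s * x) Set.univ := by
    intro s hs
    refine LipschitzWith.lipschitzOnWith (LipschitzWith.of_dist_le_mul fun x y => ?_)
    have hs' := hK s (abs_lt.mpr hs).le
    rw [dist_eq_norm, dist_eq_norm, ← mul_sub, Real.coe_toNNReal _ ((norm_nonneg _).trans hs')]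
    exact (norm_mul_le _ _).trans (mul_le_mul_of_nonneg_right hs' (norm_nonneg _))
  exact ODE_solution_unique_of_mem_Ioo (t₀ := 0) hlip
    (abs_lt.mp (by simp only [abs_zero, R]; positivity))
    (fun s _ => ⟨hX s, trivial⟩) (fun s _ => ⟨hY s, trivial⟩) h0 (abs_lt.mp (lt_add_one _))

/-- The coefficient `exp(-tC) b(t) exp(tC)` in the interaction picture. -/
noncomputable def interaction (C : 𝔸) (b : ℝ → 𝔸) (t : ℝ) : 𝔸 :=
  NormedSpace.exp (-(t • C)) * b t * NormedSpace.exp (t • C)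

/-- The fundamental solution of `dX/dt = A(t) X`, as a perturbation of `exp(tC)`. -/
noncomputable def fundamentalSolution (C : 𝔸) (A : ℝ → 𝔸) (t : ℝ) : 𝔸 :=
  NormedSpace.exp (t • C) * volterraSum (interaction C fun s => A s - C) t

variable [CompleteSpace 𝔸] {C : 𝔸}

theorem exp_smul_mul_exp_neg_smul (C : 𝔸) (t : ℝ) :
    NormedSpace.exp (t • C) * NormedSpace.exp (-(t • C)) = 1 := by
  let _ : NormedAlgebra ℚ 𝔸 := NormedAlgebra.restrictScalars ℚ ℝ 𝔸
  rw [← NormedSpace.exp_add_of_commute (Commute.refl (t • C)).neg_right, add_neg_cancel,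
    NormedSpace.exp_zero]

theorem continuous_interaction (C : 𝔸) {b : ℝ → 𝔸} (hb : Continuous b) :
    Continuous (interaction C b) := by
  let _ : NormedAlgebra ℚ 𝔸 := NormedAlgebra.restrictScalars ℚ ℝ 𝔸
  have hexp : Continuous (NormedSpace.exp : 𝔸 → 𝔸) := NormedSpace.exp_continuous
  unfold interaction
  fun_prop

omit [CompleteSpace 𝔸] in
theorem fundamentalSolution_zero (C : 𝔸) (A : ℝ → 𝔸) : fundamentalSolution C A 0 = 1 := by
  simp [fundamentalSolution, volterraSum_zero]

theorem hasDerivAt_fundamentalSolution (C : 𝔸) {A : ℝ → 𝔸} (hA : Continuous A) (t : ℝ) :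
    HasDerivAt (fundamentalSolution C A) (A t * fundamentalSolution C A t) t := by
  have hB : Continuous (interaction C fun s => A s - C) :=
    continuous_interaction C (hA.sub continuous_const)
  convert! (hasDerivAt_exp_smul_const' (𝕂 := ℝ) C t).mul (hasDerivAt_volterraSum hB t) using 1
  have h := exp_smul_mul_exp_neg_smul C t
  simp only [fundamentalSolution, interaction]
  set Y := volterraSum (interaction C fun s => A s - C) t
  calc A t * (NormedSpace.exp (t • C) * Y)
      = C * NormedSpace.exp (t • C) * Y + 1 * (A t - C) * NormedSpace.exp (t • C) * Y := by
        noncomm_ring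
    _ = _ := by
        rw [← h]
        noncomm_ring

/-- The constant does not depend on `b`, so it serves uniformly in ε and also for the remainder. -/
theorem exists_norm_interaction_le (C : 𝔸) (T : ℝ) :
    ∃ E, 0 ≤ E ∧ ∀ (b : ℝ → 𝔸) (s : ℝ), |s| ≤ T → ‖interaction C b s‖ ≤ E * ‖b s‖ := by
  let _ : NormedAlgebra ℚ 𝔸 := NormedAlgebra.restrictScalars ℚ ℝ 𝔸
  have hexp : Continuous (NormedSpace.exp : 𝔸 → 𝔸) := NormedSpace.exp_continuous
  obtain ⟨E, hE⟩ := exists_norm_le_of_abs_le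
    (by fun_prop : Continuous fun s : ℝ => NormedSpace.exp (s • C)) T
  refine ⟨E * E, mul_self_nonneg E, fun b s hs => ?_⟩
  have h1 := hE s hs
  have h2 := hE (-s) (by rwa [abs_neg])
  rw [neg_smul] at h2
  have hE0 := (norm_nonneg _).trans h1
  calc ‖interaction C b s‖ ≤ E * ‖b s‖ * E := by
        refine (norm_mul_le _ _).trans (mul_le_mul ((norm_mul_le _ _).trans ?_) h1
          (norm_nonneg _) (by positivity))
        gcongr
    _ = E * E * ‖b s‖ := by ring

/-- First-order perturbation theory for the fundamental solution in the interaction picture. -/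
theorem norm_volterraSum_interaction_sub_le {A b : ℝ → 𝔸} (hA : Continuous A) (hb : Continuous b)
    {E T κ ρ : ℝ} (hT : 0 ≤ T) (hE0 : 0 ≤ E)
    (hE : ∀ (b : ℝ → 𝔸) (s : ℝ), |s| ≤ T → ‖interaction C b s‖ ≤ E * ‖b s‖)
    (hκ : ∀ s, |s| ≤ T → ‖A s - C‖ ≤ κ) (hρ : ∀ s, |s| ≤ T → ‖A s - C - b s‖ ≤ ρ)
    (hsmall : E * κ * T ≤ 1) :
    ‖volterraSum (interaction C fun s => A s - C) T - 1 - ∫ s in (0 : ℝ)..T, interaction C b s‖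
      ≤ ‖(1 : 𝔸)‖ * (E * κ * T) ^ 2 + E * ρ * T := by
  have hB : Continuous (interaction C fun s => A s - C) :=
    continuous_interaction C (hA.sub continuous_const)
  have h1 := norm_volterraSum_sub_le hB hT
    (fun s hs => (hE _ s hs).trans (mul_le_mul_of_nonneg_left (hκ s hs) hE0)) hsmall
  have h2 : ‖(∫ s in (0 : ℝ)..T, interaction C (fun s => A s - C) s)
      - ∫ s in (0 : ℝ)..T, interaction C b s‖ ≤ E * ρ * T := by
    rw [← intervalIntegral.integral_sub (hB.intervalIntegrable _ _)
      ((continuous_interaction C hb).intervalIntegrable _ _)]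
    have := intervalIntegral.norm_integral_le_of_norm_le_const (a := 0) (b := T) (C := E * ρ)
      (f := fun s => interaction C (fun s => A s - C) s - interaction C b s) fun s hs => ?_
    · simpa [abs_of_nonneg hT] using this
    · rw [Set.uIoc_of_le hT] at hs
      have hs' : |s| ≤ T := abs_le.mpr ⟨by linarith [hs.1], hs.2⟩
      have h3 : interaction C (fun s => A s - C) s - interaction C b s
          = interaction C (fun s => A s - C - b s) s := by
        simp only [interaction]
        noncomm_ring
      rw [h3]
      exact (hE _ s hs').trans (mul_le_mul_of_nonneg_left (hρ s hs') hE0)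
  calc _ = ‖(volterraSum (interaction C fun s => A s - C) T - 1
          - ∫ s in (0 : ℝ)..T, interaction C (fun s => A s - C) s)
          + ((∫ s in (0 : ℝ)..T, interaction C (fun s => A s - C) s)
          - ∫ s in (0 : ℝ)..T, interaction C b s)‖ := by rw [sub_add_sub_cancel]
    _ ≤ _ := (norm_add_le _ _).trans (add_le_add h1 h2)

end LinearODE

/-! ### Floquet decompositions and the monodromy matrix -/

section Floquet

open scoped Matrix.Norms.Operator

variable {N : ℕ} {T : ℝ} {A X Y : ℝ → Matrix (Fin N) (Fin N) ℂ}

theorem isFundamentalSolution_iff :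
    IsFundamentalSolution A X ↔ X 0 = 1 ∧ ∀ t, HasDerivAt X (A t * X t) t := by
  refine and_congr_right fun _ => forall_congr' fun t => ?_
  exact ⟨fun h => hasDerivAt_pi.mpr fun k => hasDerivAt_pi.mpr fun l => h k l,
    fun h k l => hasDerivAt_pi.mp (hasDerivAt_pi.mp h k) l⟩

theorem IsFundamentalSolution.unique (hA : Continuous A) (hX : IsFundamentalSolution A X)
    (hY : IsFundamentalSolution A Y) : X = Y := by
  rw [isFundamentalSolution_iff] at hX hY
  exact eq_of_hasDerivAt_mul hA hX.2 hY.2 (hX.1.trans hY.1.symm)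

theorem isFundamentalSolution_fundamentalSolution (C : Matrix (Fin N) (Fin N) ℂ)
    (hA : Continuous A) : IsFundamentalSolution A (fundamentalSolution C A) :=
  isFundamentalSolution_iff.mpr
    ⟨fundamentalSolution_zero C A, hasDerivAt_fundamentalSolution C hA⟩

/-- The fundamental solution of a `T`-periodic system is shifted by the monodromy matrix. -/
theorem IsFundamentalSolution.add_period (hA : Continuous A) (hper : Function.Periodic A T)
    (hX : IsFundamentalSolution A X) (t : ℝ) : X (t + T) = X t * X T := by
  rw [isFundamentalSolution_iff] at hX
  refine congrFun (eq_of_hasDerivAt_mul (X := fun t => X (t + T)) (Y := fun t => X t * X T) hA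
    (fun s => ?_) (fun s => ?_) (by simp [hX.1])) t
  · have := (hX.2 (s + T)).comp_add_const s T
    rwa [hper s] at this
  · rw [← mul_assoc]
    exact (hX.2 s).mul_const (X T)

/-- Periodicity and `X 0 = 1` give `P T = P 0 = 1`. -/
theorem IsFloquetDecomposition.exp_eq {P : ℝ → Matrix (Fin N) (Fin N) ℂ}
    {F : Matrix (Fin N) (Fin N) ℂ} (h : IsFloquetDecomposition T A P F) (hA : Continuous A)
    (hX : IsFundamentalSolution A X) : NormedSpace.exp ((T : ℂ) • F) = X T := by
  have hP : P 0 = 1 := by simpa using h.2.1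
  have hPT : P T = 1 := by simpa [hP] using h.1 0
  simpa [hPT] using congrFun (h.2.unique hA hX) T

/-- Any logarithm of the monodromy matrix works: `X t * exp (-t F)` is periodic because `X (t + T) =
X t * exp (T F)`. -/
theorem exists_isFloquetDecomposition {F : Matrix (Fin N) (Fin N) ℂ} (hA : Continuous A)
    (hper : Function.Periodic A T) (hX : IsFundamentalSolution A X)
    (hF : NormedSpace.exp ((T : ℂ) • F) = X T) :
    ∃ P, IsFloquetDecomposition T A P F := by
  have hexp : ∀ s t : ℂ, NormedSpace.exp (s • F) * NormedSpace.exp (t • F)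
      = NormedSpace.exp ((s + t) • F) := fun s t => by
    rw [add_smul, Matrix.exp_add_of_commute _ _
      (((Commute.refl F).smul_left s).smul_right t)]
  refine ⟨fun t => X t * NormedSpace.exp ((-t : ℂ) • F), fun t => ?_, ?_⟩
  · change X (t + T) * NormedSpace.exp ((-((t + T : ℝ) : ℂ)) • F)
      = X t * NormedSpace.exp ((-t : ℂ) • F)
    rw [hX.add_period hA hper, ← hF, mul_assoc, hexp]
    congr 4
    push_cast
    ring
  · convert hX using 2 with t
    rw [mul_assoc, hexp]
    simp

theorem IsFloquetExponent.hasEigenvalue_exp {μ : ℂ} (h : IsFloquetExponent T A μ)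
    (hA : Continuous A) (hX : IsFundamentalSolution A X) :
    Module.End.HasEigenvalue (Matrix.toLin' (X T)) (Complex.exp (T * μ)) := by
  obtain ⟨P, F, hPF, hμ⟩ := h
  rw [← hPF.exp_eq hA hX]
  refine Matrix.hasEigenvalue_exp ?_
  obtain ⟨v, hv⟩ := hμ.exists_hasEigenvector
  refine Module.End.hasEigenvalue_of_hasEigenvector (x := v)
    ⟨Module.End.mem_eigenspace_iff.mpr ?_, hv.2⟩
  rw [map_smul, LinearMap.smul_apply, hv.apply_eq_smul, smul_smul]

end Floquet

/-! ### First-order expansion in ε -/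

section Monodromy

open scoped Matrix.Norms.Operator

variable {N : ℕ} {T r₀ : ℝ} {A : ℂ → ℝ → Matrix (Fin N) (Fin N) ℂ}
  {a : ℕ → ℝ → Matrix (Fin N) (Fin N) ℂ} {A₀ : Matrix (Fin N) (Fin N) ℂ}

theorem HasFiniteFourierSeries.continuous {B : ℝ → Matrix (Fin N) (Fin N) ℂ}
    (h : HasFiniteFourierSeries T B) : Continuous B := by
  obtain ⟨s, c, hB⟩ := h
  rw [funext hB]
  fun_prop

theorem IsModulatedSystem.continuous_apply (hA : IsModulatedSystem T r₀ A a A₀) {ε : ℂ}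
    (hε : ‖ε‖ < r₀) : Continuous (A ε) :=
  hA.continuous.comp_continuous (f := fun t : ℝ => (ε, t)) (by fun_prop) fun _ => hε

/-- Compactness bounds `A` on a closed disc times `[-T, T]`, so the Taylor remainder estimates are
uniform in `t`. -/
theorem IsModulatedSystem.exists_norm_sub_le (hA : IsModulatedSystem T r₀ A a A₀) (hr₀ : 0 < r₀) :
    ∃ K : ℝ, 0 ≤ K ∧ ∀ ε : ℂ, ‖ε‖ ≤ r₀ / 2 → ∀ t : ℝ, |t| ≤ T →
      ‖A ε t - A₀‖ ≤ K * ‖ε‖ ∧ ‖A ε t - A₀ - ε • a 1 t‖ ≤ K * ‖ε‖ ^ 2 := by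
  have hr : 0 < r₀ / 2 := half_pos hr₀
  have hr' : r₀ / 2 < r₀ := half_lt_self hr₀
  obtain ⟨K, hK⟩ := ((isCompact_closedBall (0 : ℂ) (r₀ / 2)).prod
    (isCompact_Icc (a := -T) (b := T))).exists_bound_of_continuousOn
    (f := fun p : ℂ × ℝ => A p.1 p.2)
    (hA.continuous.mono fun p hp => (mem_closedBall_zero_iff.mp hp.1).trans_lt hr')
  refine ⟨max (2 * K / (r₀ / 2)) (max 0 (2 * (2 * K / (r₀ / 2)) / (r₀ / 2))),
    le_max_of_le_right (le_max_left _ _), fun ε hε t ht => ?_⟩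
  have h := norm_sub_sub_le_of_hasSum_pow_smul (c := fun n => a n t) (q := fun z => A z t)
    (fun z hz => hA.hasSum z hz t) hr hr'
    (fun z hz => hK (z, t) ⟨mem_closedBall_zero_iff.mpr hz, abs_le.mp ht⟩) hε
  simp only [hA.leading_const] at h
  constructor
  · exact h.1.trans (mul_le_mul_of_nonneg_right (le_max_left _ _) (norm_nonneg _))
  · exact h.2.trans (mul_le_mul_of_nonneg_right
      ((le_max_right _ _).trans (le_max_right _ _)) (by positivity))

/-- First-order expansion of the monodromy matrix in the interaction picture. -/
theorem IsModulatedSystem.isBigO_volterraSum_sub (hA : IsModulatedSystem T r₀ A a A₀) (hT : 0 < T)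
    (hr₀ : 0 < r₀) :
    (fun ε : ℂ => volterraSum (interaction A₀ fun s => A ε s - A₀) T - 1
      - ε • ∫ s in (0 : ℝ)..T, interaction A₀ (a 1) s) =O[𝓝 0] fun ε => ε ^ 2 := by
  obtain ⟨K, hK0, hK⟩ := hA.exists_norm_sub_le hr₀
  obtain ⟨E, hE0, hE⟩ := exists_norm_interaction_le A₀ T
  have ha : Continuous (a 1) := (hA.finite_fourier 1 le_rfl).continuous
  -- The constant comes from deviation `K * ‖ε‖` and remainder `K * ‖ε‖ ^ 2`.
  refine IsBigO.of_bound (‖(1 : Matrix (Fin N) (Fin N) ℂ)‖ * (E * K * T) ^ 2 + E * K * T) ?_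
  have h1 : ∀ᶠ ε : ℂ in 𝓝 0, ‖ε‖ ≤ r₀ / 2 := by
    filter_upwards [Metric.closedBall_mem_nhds (0 : ℂ) (half_pos hr₀)] with ε hε
    exact mem_closedBall_zero_iff.mp hε
  have h2 : ∀ᶠ ε : ℂ in 𝓝 0, E * (K * ‖ε‖) * T ≤ 1 := by
    have : Tendsto (fun ε : ℂ => E * (K * ‖ε‖) * T) (𝓝 0) (𝓝 (E * (K * ‖(0 : ℂ)‖) * T)) :=
      Continuous.tendsto (by fun_prop) 0
    refine (this.eventually_lt_const ?_).mono fun _ h => le_of_lt h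
    simp
  filter_upwards [h1, h2] with ε hε hsmall
  have h := norm_volterraSum_interaction_sub_le (b := fun s => ε • a 1 s) (C := A₀)
    (hA.continuous_apply (hε.trans_lt (half_lt_self hr₀))) (ha.const_smul ε) hT.le hE0 hE
    (fun s hs => (hK ε hε s hs).1) (fun s hs => (hK ε hε s hs).2) hsmall
  have h3 : ∫ s in (0 : ℝ)..T, interaction A₀ (fun s => ε • a 1 s) s
      = ε • ∫ s in (0 : ℝ)..T, interaction A₀ (a 1) s := by
    rw [← intervalIntegral.integral_smul]
    simp [interaction]
  rw [h3] at h
  refine h.trans (le_of_eq ?_)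
  rw [norm_pow]
  ring

end Monodromy

/-! ### Entries of the monodromy matrix -/

section MonodromyEntries

open scoped Matrix.Norms.Operator

variable {N : ℕ} {T r₀ : ℝ} {A : ℂ → ℝ → Matrix (Fin N) (Fin N) ℂ}
  {a : ℕ → ℝ → Matrix (Fin N) (Fin N) ℂ} {A₀ F₀ : Matrix (Fin N) (Fin N) ℂ}

theorem Matrix.IsDiag.exp_smul {C : Matrix (Fin N) (Fin N) ℂ} (hC : C.IsDiag) (z : ℂ) :
    NormedSpace.exp (z • C) = Matrix.diagonal fun k => Complex.exp (z * C k k) := by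
  rw [← Matrix.exp_diagonal_complex, ← hC.diagonal_diag, ← Matrix.diagonal_smul]
  simp [Pi.smul_def]

/-- Conjugation multiplies entry `(j, k)` by `exp (t (C k k - C j j))`, which is 1 when `j = k`. -/
theorem Matrix.IsDiag.interaction_apply_self {C : Matrix (Fin N) (Fin N) ℂ} (hC : C.IsDiag)
    (b : ℝ → Matrix (Fin N) (Fin N) ℂ) (t : ℝ) (k : Fin N) :
    interaction C b t k k = b t k k := by
  have h1 : t • C = (t : ℂ) • C := by ext; simp
  have h2 : -(t • C) = (-t : ℂ) • C := by rw [h1, neg_smul]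
  have h3 : interaction C b t
      = NormedSpace.exp (-(t • C)) * b t * NormedSpace.exp (t • C) := rfl
  rw [h3, h2, h1, hC.exp_smul, hC.exp_smul, Matrix.mul_diagonal, Matrix.diagonal_mul,
    mul_right_comm, ← Complex.exp_add]
  simp

theorem intervalIntegral_apply {b : ℝ → Matrix (Fin N) (Fin N) ℂ} (hb : Continuous b) (x y : ℝ)
    (j k : Fin N) : (∫ s in x..y, b s) j k = ∫ s in x..y, b s j k :=
  (ContinuousLinearMap.intervalIntegral_comp_comm
    (Matrix.entryLinearMap ℝ ℂ j k : Matrix (Fin N) (Fin N) ℂ →ₗ[ℝ] ℂ).toContinuousLinearMap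
    (hb.intervalIntegrable x y)).symm

theorem Matrix.isBigO_apply {f : ℂ → Matrix (Fin N) (Fin N) ℂ} {g : ℂ → ℂ} {l : Filter ℂ}
    (h : f =O[l] g) (j k : Fin N) : (fun ε => f ε j k) =O[l] g :=
  (ContinuousLinearMap.isBigO_comp (Matrix.entryLinearMap ℂ ℂ j k :
    Matrix (Fin N) (Fin N) ℂ →ₗ[ℂ] ℂ).toContinuousLinearMap f l).trans h

/-- The monodromy matrix `M ε` differs from `exp (T A₀)` to first order, and in the diagonal to
second order when `a 1` has vanishing mean. -/
theorem IsModulatedSystem.exists_monodromy (hA : IsModulatedSystem T r₀ A a A₀) (hT : 0 < T)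
    (hr₀ : 0 < r₀) (hA₁ : ∀ k l : Fin N, fourierCoeffOn hT (fun t : ℝ => a 1 t k l) 0 = 0) :
    ∃ X : ℂ → ℝ → Matrix (Fin N) (Fin N) ℂ,
      (∀ ε : ℂ, ‖ε‖ < r₀ → IsFundamentalSolution (A ε) (X ε)) ∧
      (∀ j k, (fun ε => X ε T j k - NormedSpace.exp ((T : ℂ) • A₀) j k) =O[𝓝 0] fun ε => ε) ∧
      ∀ k, (fun ε => X ε T k k - NormedSpace.exp ((T : ℂ) • A₀) k k) =O[𝓝 0] fun ε => ε ^ 2 := by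
  have hO := hA.isBigO_volterraSum_sub hT hr₀
  have ha : Continuous (a 1) := (hA.finite_fourier 1 le_rfl).continuous
  set J := ∫ s in (0 : ℝ)..T, interaction A₀ (a 1) s
  have hJ : ∀ k, J k k = 0 := by
    intro k
    have h := hA₁ k k
    rw [fourierCoeffOn_eq_integral] at h
    simp only [sub_zero, neg_zero, fourier_zero, one_smul] at h
    refine (intervalIntegral_apply (continuous_interaction A₀ ha) 0 T k k).trans ?_
    simp only [hA.leading_diag.interaction_apply_self]
    exact (smul_eq_zero.mp h).resolve_left (one_div_ne_zero hT.ne')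
  have hsq : (fun ε : ℂ => ε ^ 2) =O[𝓝 0] fun ε => ε := by
    have h1 : (fun ε : ℂ => ε) =O[𝓝 0] fun _ => (1 : ℂ) := continuousAt_id.tendsto.isBigO_one ℂ
    simpa [sq] using h1.mul (isBigO_refl (fun ε : ℂ => ε) (𝓝 0))
  -- Multiplication by the diagonal `exp (T A₀)` only rescales rows, so orders in ε are kept entry
  -- by entry.
  have hentry : ∀ ε j k, fundamentalSolution A₀ (A ε) T j k
      - NormedSpace.exp ((T : ℂ) • A₀) j k = Complex.exp (T * A₀ j j)
        * (volterraSum (interaction A₀ fun s => A ε s - A₀) T - 1) j k := by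
    intro ε j k
    have h1 : T • A₀ = (T : ℂ) • A₀ := by ext; simp
    have h2 : fundamentalSolution A₀ (A ε) T = NormedSpace.exp (T • A₀)
      * volterraSum (interaction A₀ fun s => A ε s - A₀) T := rfl
    rw [h2, h1, ← Matrix.sub_apply, ← Matrix.diagonal_mul
      (fun k => Complex.exp (T * A₀ k k)), ← hA.leading_diag.exp_smul, Matrix.mul_sub,
      Matrix.mul_one]
  refine ⟨fun ε => fundamentalSolution A₀ (A ε), fun ε hε =>
    isFundamentalSolution_fundamentalSolution A₀ (hA.continuous_apply hε), fun j k => ?_,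
    fun k => ?_⟩
  · simp only [hentry]
    refine .const_mul_left (Matrix.isBigO_apply ?_ j k) _
    have h1 : (fun ε : ℂ => ε • J) =O[𝓝 0] fun ε => ε :=
      IsBigO.of_bound ‖J‖ (Eventually.of_forall fun ε => by rw [norm_smul, mul_comm])
    simpa using (hO.trans hsq).add h1
  · simp only [hentry]
    refine .const_mul_left ?_ _
    simpa [hJ] using Matrix.isBigO_apply hO k k

end MonodromyEntries

/-! ### Injectivity of `exp (T ·)` and the normalisation of `F₀` -/

theorem Complex.eq_of_exp_mul_eq_of_norm_sub_lt {T : ℝ} (hT : 0 < T) {x y : ℂ}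
    (h : Complex.exp (T * x) = Complex.exp (T * y)) (hxy : ‖x - y‖ < 2 * Real.pi / T) : x = y := by
  obtain ⟨n, hn⟩ := Complex.exp_eq_exp_iff_exists_int.mp h
  have hT' : (T : ℂ) ≠ 0 := Complex.ofReal_ne_zero.mpr hT.ne'
  have h1 : (T : ℂ) * (x - y) = n * (2 * Real.pi * Complex.I) := by rw [mul_sub, hn]; ring
  have h2 : T * ‖x - y‖ = |(n : ℝ)| * (2 * Real.pi) := by
    have := congrArg norm h1
    simpa [abs_of_pos hT, abs_of_pos Real.pi_pos] using this
  rw [lt_div_iff₀ hT, mul_comm, h2] at hxy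
  have h3 : |(n : ℝ)| < 1 := by
    by_contra! hge
    nlinarith [Real.pi_pos]
  have hn0 : n = 0 := Int.abs_lt_one_iff.mp (by exact_mod_cast h3)
  subst hn0
  rw [Int.cast_zero, zero_mul] at h1
  exact sub_eq_zero.mp ((mul_eq_zero.mp h1).resolve_left hT')

/-- The real parts agree, and two points of a half-open interval of length `2π/T` lie strictly less
than `2π/T` apart. -/
theorem Complex.eq_of_exp_mul_eq_of_im_mem {T : ℝ} (hT : 0 < T) {x y : ℂ}
    (h : Complex.exp (T * x) = Complex.exp (T * y))
    (hx : x.im ∈ Set.Ioc (-(Real.pi / T)) (Real.pi / T))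
    (hy : y.im ∈ Set.Ioc (-(Real.pi / T)) (Real.pi / T)) : x = y := by
  refine Complex.eq_of_exp_mul_eq_of_norm_sub_lt hT h ?_
  obtain ⟨n, hn⟩ := Complex.exp_eq_exp_iff_exists_int.mp h
  have hre : (x - y).re = 0 := by
    have := congrArg Complex.re hn
    have h' : T * x.re = T * y.re := by simpa using this
    rw [Complex.sub_re, mul_left_cancel₀ hT.ne' h', sub_self]
  have him : ‖x - y‖ = |(x - y).im| := by
    rw [Complex.norm_def, Complex.normSq_apply, hre, mul_zero, zero_add, Real.sqrt_mul_self_eq_abs]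
  rw [him, Complex.sub_im, abs_lt, mul_div_assoc]
  constructor <;> linarith [hx.1, hx.2, hy.1, hy.2]

theorem IsConstantOrderFloquetMatrix.exp_eq {N : ℕ} {T : ℝ} (hT : 0 < T)
    {A₀ F₀ : Matrix (Fin N) (Fin N) ℂ} (h : IsConstantOrderFloquetMatrix T A₀ F₀)
    (hA₀ : A₀.IsDiag) : NormedSpace.exp ((T : ℂ) • A₀) = NormedSpace.exp ((T : ℂ) • F₀) := by
  rw [hA₀.exp_smul, h.diag.exp_smul]
  congr 1
  funext k
  obtain ⟨n, hn⟩ := h.congr k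
  have hT' : (T : ℂ) ≠ 0 := Complex.ofReal_ne_zero.mpr hT.ne'
  refine Complex.exp_eq_exp_iff_exists_int.mpr ⟨n, ?_⟩
  rw [eq_add_of_sub_eq hn]
  field_simp
  ring

/-! ### The main theorem -/

theorem mainTheorem5 {N : ℕ} (T r₀ : ℝ) (hT : 0 < T) (hr₀ : 0 < r₀)
    (A : ℂ → ℝ → Matrix (Fin N) (Fin N) ℂ)
    (a : ℕ → ℝ → Matrix (Fin N) (Fin N) ℂ)
    (A₀ F₀ : Matrix (Fin N) (Fin N) ℂ)
    (hA : IsModulatedSystem T r₀ A a A₀)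
    (hF₀ : IsConstantOrderFloquetMatrix T A₀ F₀)
    (i : Fin N) (hsimple : ∀ j : Fin N, j ≠ i → F₀ j j ≠ F₀ i i)
    (hA₁ : ∀ k l : Fin N, fourierCoeffOn hT (fun t : ℝ => a 1 t k l) 0 = 0) :
    ∃ f : ℂ → ℂ,
      f 0 = F₀ i i ∧
      -- near `F₀ i i`, the number `f ε` is the one and only Floquet exponent of the system
      (∃ δ : ℝ, 0 < δ ∧ ∀ᶠ ε in 𝓝 (0 : ℂ),
        IsFloquetExponent T (A ε) (f ε) ∧ ‖f ε - F₀ i i‖ < δ ∧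
        ∀ μ : ℂ, IsFloquetExponent T (A ε) μ → ‖μ - F₀ i i‖ < δ → μ = f ε) ∧
      -- `f ε` is an eigenvalue of the Floquet exponent matrix that continues `F₀`
      (∀ (F : ℂ → Matrix (Fin N) (Fin N) ℂ) (P : ℂ → ℝ → Matrix (Fin N) (Fin N) ℂ),
        F 0 = F₀ → ContinuousAt F 0 →
        (∀ᶠ ε in 𝓝 (0 : ℂ), IsFloquetDecomposition T (A ε) (P ε) (F ε)) →
        ∀ᶠ ε in 𝓝 (0 : ℂ), Module.End.HasEigenvalue (Matrix.toLin' (F ε)) (f ε)) ∧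
      (fun ε : ℂ => f ε - F₀ i i) =O[𝓝 0] (fun ε : ℂ => ε ^ 2) := by

  classical
  obtain ⟨X, hX, hXO, hXO2⟩ := hA.exists_monodromy hT hr₀ hA₁
  rw [hF₀.exp_eq hT hA.leading_diag] at hXO hXO2
  have hT' : (T : ℂ) ≠ 0 := Complex.ofReal_ne_zero.mpr hT.ne'
  set D := NormedSpace.exp ((T : ℂ) • F₀)
  have hDdiag : D = Matrix.diagonal fun k => Complex.exp (T * F₀ k k) := hF₀.diag.exp_smul T
  have hDapp : ∀ k, D k k = Complex.exp (T * F₀ k k) := fun k => by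
    rw [hDdiag, Matrix.diagonal_apply_eq]
  have hinj : ∀ j k, Complex.exp (T * F₀ j j) = Complex.exp (T * F₀ k k) → F₀ j j = F₀ k k :=
    fun j k h => Complex.eq_of_exp_mul_eq_of_im_mem hT h (hF₀.im_mem j) (hF₀.im_mem k)
  have hnear : ∀ᶠ ε : ℂ in 𝓝 0, ‖ε‖ < r₀ := by
    filter_upwards [Metric.ball_mem_nhds (0 : ℂ) hr₀] with ε hε
    exact mem_ball_zero_iff.mp hε
  -- the monodromy matrix is continuous at `0`
  have hM : Tendsto (fun ε => X ε T) (𝓝 0) (𝓝 D) :=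
    tendsto_pi_nhds.mpr fun j => tendsto_pi_nhds.mpr fun k =>
      tendsto_sub_nhds_zero_iff.mp ((hXO j k).trans_tendsto tendsto_id)
  -- A function that is O(ε) at `0` vanishes at `ε = 0` itself.
  have hM0 : X 0 T = D := by
    ext j k
    exact sub_eq_zero.mp ((hXO j k).eq_zero_imp.self_of_nhds rfl)
  -- its logarithm
  have hTF : Matrix.diagonal (fun k => T * F₀ k k) = (T : ℂ) • F₀ := by
    conv_rhs => rw [← hF₀.diag.diagonal_diag, ← Matrix.diagonal_smul]
    rfl
  obtain ⟨ψ, hψ, hψr, hψl⟩ := Matrix.exists_local_log_diagonal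
    (d := fun k => (T : ℂ) * F₀ k k) fun j k h => by rw [hinj j k h]
  rw [hTF] at hψ hψr hψl
  set G : ℂ → Matrix (Fin N) (Fin N) ℂ := fun ε => (T : ℂ)⁻¹ • ψ (X ε T)
  have hG : Tendsto G (𝓝 0) (𝓝 F₀) := by
    have := (hψ.comp hM).const_smul (T : ℂ)⁻¹
    rwa [inv_smul_smul₀ hT'] at this
  have hG0 : G 0 = F₀ := by
    simp only [G, hM0]
    rw [hψl.self_of_nhds, inv_smul_smul₀ hT']
  have hGexp : ∀ᶠ ε in 𝓝 (0 : ℂ), NormedSpace.exp ((T : ℂ) • G ε) = X ε T := by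
    filter_upwards [hM.eventually hψr] with ε hε
    rw [smul_inv_smul₀ hT', hε]
  -- The eigenvalue branch `φ` at `F₀` defines `f`; the branch `θ` at `D` tracks `exp (T f)` and
  -- yields uniqueness and the order estimate.
  obtain ⟨φ, hφ0, hφt, hφ, -, -⟩ := hF₀.diag.exists_simple_eigenvalue hsimple
  have hDd : D.IsDiag := hDdiag ▸ Matrix.isDiag_diagonal _
  obtain ⟨θ, -, -, -, hθ, hθO⟩ := hDd.exists_simple_eigenvalue (i := i) fun j hj h =>
    hsimple j hj (hinj j i (by rwa [← hDapp, ← hDapp]))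
  set f : ℂ → ℂ := fun ε => φ (G ε)
  have hf : Tendsto f (𝓝 0) (𝓝 (F₀ i i)) := hφt.comp hG
  have hfG : ∀ᶠ ε in 𝓝 (0 : ℂ), Module.End.HasEigenvalue (Matrix.toLin' (G ε)) (f ε) :=
    hG.eventually hφ
  have hfexp : ∀ᶠ ε in 𝓝 (0 : ℂ), IsFloquetExponent T (A ε) (f ε) := by
    filter_upwards [hnear, hGexp, hfG] with ε hε h1 h2
    obtain ⟨P, hP⟩ := exists_isFloquetDecomposition (hA.continuous_apply hε) (hA.periodic ε hε)
      (hX ε hε) h1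
    exact ⟨P, G ε, hP, h2⟩
  have hθ' : ∀ᶠ p in 𝓝 ((0 : ℂ), F₀ i i),
      IsFloquetExponent T (A p.1) p.2 → θ (X p.1 T) = Complex.exp (T * p.2) := by
    have ht : Tendsto (fun p : ℂ × ℂ => (X p.1 T, Complex.exp (T * p.2))) (𝓝 (0, F₀ i i))
        (𝓝 (D, D i i)) := by
      rw [hDapp]
      refine (hM.comp (continuous_fst.tendsto ((0 : ℂ), F₀ i i))).prodMk_nhds ?_
      exact Continuous.tendsto (by fun_prop) ((0 : ℂ), F₀ i i)
    filter_upwards [ht.eventually hθ, (continuous_fst.tendsto ((0 : ℂ), F₀ i i)).eventually hnear] with p hp hpn h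
    exact hp (h.hasEigenvalue_exp (hA.continuous_apply hpn) (hX _ hpn))
  have hθf : ∀ᶠ ε in 𝓝 (0 : ℂ), θ (X ε T) = Complex.exp (T * f ε) := by
    filter_upwards [(tendsto_id.prodMk_nhds hf).eventually hθ', hfexp] with ε h1 h2
    exact h1 h2
  refine ⟨f, ?_, ?_, ?_, ?_⟩
  · simp only [f, hG0, hφ0]
  · rw [nhds_prod_eq] at hθ'
    obtain ⟨U, hU, V, hV, hUV⟩ := eventually_prod_iff.mp hθ'
    obtain ⟨δ, hδ, hδV⟩ := Metric.eventually_nhds_iff.mp hV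
    have hδ' : 0 < min δ (Real.pi / T) := lt_min hδ (div_pos Real.pi_pos hT)
    -- Two exponents within `π/T` of `F₀ i i` are less than `2π/T` apart, so equal exponentials
    -- force equality.
    refine ⟨min δ (Real.pi / T), hδ', ?_⟩
    have hfδ : ∀ᶠ ε in 𝓝 (0 : ℂ), ‖f ε - F₀ i i‖ < min δ (Real.pi / T) := by
      filter_upwards [hf.eventually (Metric.ball_mem_nhds _ hδ')] with ε hε
      rwa [← dist_eq_norm]
    filter_upwards [hfexp, hfδ, hU, hθf] with ε h1 h2 h3 h4
    refine ⟨h1, h2, fun μ hμ hμδ => ?_⟩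
    have h5 := hUV h3 (hδV (by rw [dist_eq_norm]; exact hμδ.trans_le (min_le_left _ _))) hμ
    refine Complex.eq_of_exp_mul_eq_of_norm_sub_lt hT (h5.symm.trans h4) ?_
    have h6 := hμδ.trans_le (min_le_right _ _)
    have h7 := h2.trans_le (min_le_right _ _)
    calc ‖μ - f ε‖ = ‖(μ - F₀ i i) - (f ε - F₀ i i)‖ := by rw [sub_sub_sub_cancel_right]
      _ ≤ ‖μ - F₀ i i‖ + ‖f ε - F₀ i i‖ := norm_sub_le _ _
      _ < Real.pi / T + Real.pi / T := add_lt_add h6 h7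
      _ = 2 * Real.pi / T := by ring
  · intro F P hF0 hFc hFP
    have hTF' : Tendsto (fun ε => (T : ℂ) • F ε) (𝓝 0) (𝓝 ((T : ℂ) • F₀)) := by
      have := (hFc.tendsto).const_smul (T : ℂ)
      rwa [hF0] at this
    filter_upwards [hFP, hTF'.eventually hψl, hnear, hfG] with ε h1 h2 hε h3
    have h4 := h1.exp_eq (hA.continuous_apply hε) (hX ε hε)
    -- The left-inverse property of the local logarithm recovers `T F ε` from the monodromy matrix.
    have h5 : G ε = F ε := by
      simp only [G]
      rw [← h4, h2, inv_smul_smul₀ hT']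
    rwa [h5] at h3
  · have h1 : (fun ε => Complex.exp (T * f ε) - Complex.exp (T * F₀ i i))
        =O[𝓝 0] fun ε => ε ^ 2 := by
      have h := (hθO (fun ε => X ε T) hXO).add (hXO2 i)
      refine h.congr' ?_ EventuallyEq.rfl
      filter_upwards [hθf] with ε hε
      rw [hε, ← hDapp]
      ring
    have h2 : HasDerivAt (fun z : ℂ => Complex.exp (T * z))
        (Complex.exp (T * F₀ i i) * (T * 1)) (F₀ i i) :=
      ((hasDerivAt_id (F₀ i i)).const_mul (T : ℂ)).cexp
    -- The derivative `T exp (T F₀ i i)` is nonzero, so increments of the exponent and of its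
    -- exponential have the same order.
    have h3 := (h2.isTheta_sub (by simp [hT', Complex.exp_ne_zero])).isBigO_symm
    exact (h3.comp_tendsto (hf.prodMk tendsto_const_pure)).trans h1
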